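/- Let $\Omega=\{x\in\mathbb R^2 : |x|<1\}$ be the unit disk with polar coordinates $(r,\phi)$, and let $\gamma\in L^2(\Omega)$ be real-valued. For a boundary function $f(\phi)$ on $\partial\Omega$ let $u_f$ be the solution of $\Delta u_f=0$ in $\Omega$, $u_f=f$ on $\partial\Omega$. The linearized Dirichlet-to-Neumann map (linearized in the conductivity around the constant $1$) is given by $$\langle \Lambda' f,g\rangle=\int_\Omega \gamma\,\nabla u_f\cdot\nabla u_g\,dx ,$$ and its entries in the trigonometric basis include, for $i,j\ge 1$, $$K^{cc}_{i,j}=\langle\Lambda'\cos(i\phi),\cos(j\phi)\rangle,\qquad K^{cs}_{i,j}=\langle\Lambda'\cos(i\phi),\sin(j\phi)\rangle .$$ For $k,n\ge 0$ define the Müntz–Legendre polynomials $$L^{(k)}_n(x)=\sum_{l=0}^n c^{(k)}_{l,n}\,x^{2l+k},\qquad c^{(k)}_{l,n}=\frac{\prod_{j=0}^{n-1}(l+j+k+1)}{\prod_{j=0,\,j\ne l}^{n}(l-j)},$$ and the coefficients $$p_{n,k}=\sum_{l=0}^n 2(-1)^{n-l}(2n+k+1)\,\frac{\prod_{j=0}^{n-1}(1+k+l+j)}{l!\,(n-l)!}\;\frac{K^{cc}_{l+1,l+1+k}}{(l+1)(l+1+k)\pi},$$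 $$q_{n,k}=\sum_{l=0}^n 2(-1)^{n-l}(2n+k+1)\,\frac{\prod_{j=0}^{n-1}(1+k+l+j)}{l!\,(n-l)!}\;\frac{K^{cs}_{l+1,l+1+k}}{(l+1)(l+1+k)\pi}.$$ Then $\gamma$ is recovered from the entries $K^{cc}$ and $K^{cs}$ by $$\gamma(r,\phi)=\frac12\sum_{n=0}^\infty p_{n,0}\,L^{(0)}_n(r)+\sum_{k=1}^\infty\sum_{n=0}^\infty p_{n,k}\,L^{(k)}_n(r)\cos(k\phi)+\sum_{k=1}^\infty\sum_{n=0}^\infty q_{n,k}\,L^{(k)}_n(r)\sin(k\phi),$$ where the equality holds in $L^2(\Omega)$ and each of the three series (the last two as families indexed by the pairs $(k,n)$) converges unconditionally in $L^2(\Omega)$. -/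

import Mathlib

open MeasureTheory Complex

noncomputable section

namespace DiskEIT

/-- The open unit disk `Ω`, the plane `ℝ²` being identified with `ℂ`. -/
def disk : Set ℂ := Metric.ball 0 1

/-- Lebesgue measure on the unit disk. -/
def diskMeasure : Measure ℂ := volume.restrict disk

instance instIsFiniteMeasureDiskMeasure : IsFiniteMeasure diskMeasure :=
  ⟨by simp [diskMeasure, disk]⟩

/-- `u` solves the Dirichlet problem `Δ u = 0` in `Ω`, `u = f` on `∂Ω`, where the boundary data
`f` is given as a function of the angle `φ`: `u` is harmonic in the open disk, continuous up to
the boundary, and `u (e ^ (i φ)) = f φ`. -/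
def IsDirichletSolution (f : ℝ → ℝ) (u : ℂ → ℝ) : Prop :=
  InnerProductSpace.HarmonicContOnCl u disk ∧ ∀ φ : ℝ, u (exp (φ * I)) = f φ

open Classical in
/-- The solution of the Dirichlet problem for the Laplace equation with boundary data `f`. It
exists for every continuous `2 π`-periodic `f`, and its values on the closed disk are unique. (The
value `0` is used where no solution exists.) -/
def harmonicExtension (f : ℝ → ℝ) : ℂ → ℝ :=
  if h : ∃ u, IsDirichletSolution f u then h.choose else 0

/-- The linearized Dirichlet-to-Neumann form
`⟨Λ' f, g⟩ = ∫_Ω γ ∇u_f ⬝ ∇u_g dx`, where `u_f`, `u_g` are the harmonic functions in the disk with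
boundary values `f`, `g`. -/
def linearizedDtN (γ : ℂ → ℝ) (f g : ℝ → ℝ) : ℝ :=
  ∫ z, γ z * inner ℝ (gradient (harmonicExtension f) z) (gradient (harmonicExtension g) z)
    ∂diskMeasure

/-- `K^{cc}_{i,j} = ⟨Λ' cos(i φ), cos(j φ)⟩`. -/
def Kcc (γ : ℂ → ℝ) (i j : ℕ) : ℝ :=
  linearizedDtN γ (fun φ => Real.cos (i * φ)) (fun φ => Real.cos (j * φ))

/-- `K^{cs}_{i,j} = ⟨Λ' cos(i φ), sin(j φ)⟩`. -/
def Kcs (γ : ℂ → ℝ) (i j : ℕ) : ℝ :=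
  linearizedDtN γ (fun φ => Real.cos (i * φ)) (fun φ => Real.sin (j * φ))

/-- The coefficient of `x ^ (2 l + k)` in the Müntz–Legendre polynomial `L^{(k)}_n`. -/
def mlCoeff (k l n : ℕ) : ℝ :=
  (∏ j ∈ Finset.range n, ((l : ℝ) + j + k + 1)) /
    ∏ j ∈ (Finset.range (n + 1)).erase l, ((l : ℝ) - j)

/-- The Müntz–Legendre polynomial `L^{(k)}_n (x) = ∑_{l ≤ n} c_{l,n} x ^ (2 l + k)`. -/
def muntzLegendre (k n : ℕ) (x : ℝ) : ℝ :=
  ∑ l ∈ Finset.range (n + 1), mlCoeff k l n * x ^ (2 * l + k)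

/-- The reconstruction coefficients computed from a data matrix `K`; `p_{n,k}` is the value for
`K = K^{cc}`, and `q_{n,k}` the value for `K = K^{cs}`. -/
def recCoeff (K : ℕ → ℕ → ℝ) (n k : ℕ) : ℝ :=
  ∑ l ∈ Finset.range (n + 1),
    2 * (-1 : ℝ) ^ (n - l) * (2 * n + k + 1) *
      ((∏ j ∈ Finset.range n, (1 + (k : ℝ) + (l + j))) /
        ((Nat.factorial l : ℝ) * (Nat.factorial (n - l) : ℝ))) *
      (K (l + 1) (l + 1 + k) / (((l : ℝ) + 1) * (l + 1 + k) * Real.pi))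

lemma continuous_muntzLegendre (k n : ℕ) : Continuous (muntzLegendre k n) := by
  unfold muntzLegendre
  fun_prop

lemma memLp_radial_mul {L g : ℝ → ℝ} (hL : Continuous L) (hg : Measurable g)
    (hg1 : ∀ x, |g x| ≤ 1) :
    MemLp (fun z : ℂ => L ‖z‖ * g (arg z)) 2 diskMeasure := by
  obtain ⟨C, hC⟩ := (isCompact_Icc (a := (0 : ℝ)) (b := 1)).exists_bound_of_continuousOn
    hL.continuousOn
  refine MemLp.of_bound (C := C) ?_ ?_
  · exact ((hL.measurable.comp measurable_norm).mul
      (hg.comp measurable_arg)).aestronglyMeasurable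
  · refine (ae_restrict_iff' Metric.isOpen_ball.measurableSet).2 (Filter.Eventually.of_forall ?_)
    intro z hz
    have hz1 : ‖z‖ < 1 := by simpa using hz
    have h1 := hC ‖z‖ ⟨norm_nonneg z, hz1.le⟩
    rw [norm_mul]
    calc ‖L ‖z‖‖ * ‖g (arg z)‖ ≤ C * 1 :=
          mul_le_mul h1 (hg1 _) (norm_nonneg _) ((norm_nonneg _).trans h1)
      _ = C := mul_one C

lemma memLp_cosMode (k n : ℕ) :
    MemLp (fun z : ℂ => muntzLegendre k n ‖z‖ * Real.cos (k * arg z)) 2 diskMeasure :=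
  memLp_radial_mul (g := fun φ => Real.cos (k * φ)) (continuous_muntzLegendre k n)
    (by fun_prop) (fun _ => Real.abs_cos_le_one _)

lemma memLp_sinMode (k n : ℕ) :
    MemLp (fun z : ℂ => muntzLegendre k n ‖z‖ * Real.sin (k * arg z)) 2 diskMeasure :=
  memLp_radial_mul (g := fun φ => Real.sin (k * φ)) (continuous_muntzLegendre k n)
    (by fun_prop) (fun _ => Real.abs_sin_le_one _)

/-- The function `L^{(k)}_n (r) cos(k φ)` as an element of `L²(Ω)`, in polar coordinates
`r = |z|`, `φ = arg z`. -/
def cosMode (k n : ℕ) : Lp ℝ 2 diskMeasure := (memLp_cosMode k n).toLp _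

/-- The function `L^{(k)}_n (r) sin(k φ)` as an element of `L²(Ω)`, in polar coordinates
`r = |z|`, `φ = arg z`. -/
def sinMode (k n : ℕ) : Lp ℝ 2 diskMeasure := (memLp_sinMode k n).toLp _

end DiskEIT

end

namespace DiskEIT

open Metric InnerProductSpace
open scoped ComplexConjugate Real

/-! ### The Dirichlet problem for trigonometric boundary data -/

/-! The harmonic extensions of cos(iφ) and sin(jφ) are Re z^i and Im z^j, so their gradients are
explicit. For the index pair (l+1, l+1+k) the product of gradients is (l+1)(l+1+k) r^(2l+k) times
cos(kφ) or sin(kφ). Up to this factor, the k-th superdiagonal of the data therefore lists the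
moments of γ against r^(2l+k) cos(kφ) or r^(2l+k) sin(kφ) (`Kcc_eq`, `Kcs_eq`).

For fixed k the polynomials L^(k)_n are orthogonal combinations of r^k, r^(k+2), ... in L²((0,1), r
dr); this rests on a Lagrange interpolation identity (`sum_mlCoeff_div`). Together with
trigonometric orthogonality it makes the modes an orthogonal family in L²(Ω). The reconstruction
coefficients apply the coefficients of L^(k)_n to the moments, and so are the Fourier coefficients
⟨mode, γ⟩/‖mode‖² (`recCoeff_eq`), except that for k = 0 they are twice as large, whence the factor
1/2.

The family is complete: a function orthogonal to every mode is orthogonal to every z^a conj(z)^b,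
hence by Stone–Weierstrass to every continuous function, hence zero
(`ae_eq_zero_of_orthogonal_modes`). The formula is then the expansion of γ in an orthogonal basis.
-/

lemma IsDirichletSolution.eqOn {f : ℝ → ℝ} {u v : ℂ → ℝ} (hu : IsDirichletSolution f u)
    (hv : IsDirichletSolution f v) : Set.EqOn u v disk := by
  intro w hw
  -- Poisson's formula expresses both values through the common boundary data.
  rw [← hu.1.circleAverage_poissonKernel_smul hw, ← hv.1.circleAverage_poissonKernel_smul hw]
  refine Real.circleAverage_congr_sphere fun z hz => ?_
  have h1 : ‖z‖ = 1 := by simpa using hz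
  have h2 : exp (arg z * I) = z := by
    simpa [h1] using norm_mul_exp_arg_mul_I z
  have h3 : u z = v z := by rw [← h2, hu.2, hv.2]
  simp [h3]

/-- The extension is an arbitrary choice of solution, but solutions agree on the open disk and the
gradient is local, so any explicit solution may replace it. -/
lemma gradient_harmonicExtension {f : ℝ → ℝ} {u : ℂ → ℝ} (hu : IsDirichletSolution f u) {z : ℂ}
    (hz : z ∈ disk) : gradient (harmonicExtension f) z = gradient u z := by
  have h : ∃ u, IsDirichletSolution f u := ⟨u, hu⟩
  have h1 : harmonicExtension f = h.choose := dif_pos h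
  have h2 : harmonicExtension f =ᶠ[nhds z] u := by
    rw [h1]
    exact (h.choose_spec.eqOn hu).eventuallyEq_of_mem (isOpen_ball.mem_nhds hz)
  simp only [gradient, h2.fderiv_eq]

lemma isDirichletSolution_cos (k : ℕ) :
    IsDirichletSolution (fun φ => Real.cos (k * φ)) (fun z => (z ^ k).re) := by
  refine ⟨HarmonicOnNhd.harmonicContOnCl fun z _ => ?_, fun φ => ?_⟩
  · exact AnalyticAt.harmonicAt_re (f := fun z => z ^ k) (by fun_prop)
  · change (exp (φ * I) ^ k).re = Real.cos (k * φ)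
    rw [← exp_nat_mul, ← mul_assoc, ← Complex.exp_ofReal_mul_I_re]
    push_cast; rfl

lemma isDirichletSolution_sin (k : ℕ) :
    IsDirichletSolution (fun φ => Real.sin (k * φ)) (fun z => (z ^ k).im) := by
  refine ⟨HarmonicOnNhd.harmonicContOnCl fun z _ => ?_, fun φ => ?_⟩
  · exact AnalyticAt.harmonicAt_im (f := fun z => z ^ k) (by fun_prop)
  · change (exp (φ * I) ^ k).im = Real.sin (k * φ)
    rw [← exp_nat_mul, ← mul_assoc, ← Complex.exp_ofReal_mul_I_im]
    push_cast; rfl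

/-- The differential of Re F is w ↦ Re(a w), which is the real inner product of conj a with w. -/
lemma gradient_re_comp {F : ℂ → ℂ} {a z : ℂ} (h : HasDerivAt F a z) :
    gradient (fun w => (F w).re) z = conj a := by
  refine HasGradientAt.gradient ?_
  rw [hasGradientAt_iff_hasFDerivAt]
  convert! reCLM.hasFDerivAt.comp z (h.hasFDerivAt.restrictScalars ℝ) using 1
  ext w
  simp [Complex.inner]

lemma gradient_im_comp {F : ℂ → ℂ} {a z : ℂ} (h : HasDerivAt F a z) :
    gradient (fun w => (F w).im) z = I * conj a := by
  -- Im F = Re(-I F).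
  have h1 := gradient_re_comp (h.const_mul (-I))
  simpa using h1

lemma pow_re_eq (z : ℂ) (k : ℕ) : (z ^ k).re = ‖z‖ ^ k * Real.cos (k * arg z) := by
  conv_lhs => rw [← norm_mul_exp_arg_mul_I z, mul_pow, ← exp_nat_mul, ← mul_assoc]
  rw [← ofReal_pow, re_ofReal_mul, ← Complex.exp_ofReal_mul_I_re]
  push_cast; rfl

lemma pow_im_eq (z : ℂ) (k : ℕ) : (z ^ k).im = ‖z‖ ^ k * Real.sin (k * arg z) := by
  conv_lhs => rw [← norm_mul_exp_arg_mul_I z, mul_pow, ← exp_nat_mul, ← mul_assoc]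
  rw [← ofReal_pow, im_ofReal_mul, ← Complex.exp_ofReal_mul_I_im]
  push_cast; rfl

lemma pow_mul_conj_pow (z : ℂ) (l k : ℕ) :
    z ^ l * conj z ^ (l + k) = ((‖z‖ ^ (2 * l) : ℝ) : ℂ) * conj (z ^ k) := by
  rw [pow_add, ← mul_assoc, ← mul_pow, mul_conj, normSq_eq_norm_sq, map_pow]
  push_cast
  ring

lemma hasDerivAt_pow_succ (z : ℂ) (l : ℕ) :
    HasDerivAt (fun w : ℂ => w ^ (l + 1)) ((l + 1) * z ^ l) z := by
  simpa using hasDerivAt_pow (l + 1) z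

/-- The inner product of the gradients is a multiple of Re(z^l conj(z)^(l+k)) = r^(2l) Re(z^k): the
matrix entries are moments of γ. -/
lemma Kcc_eq (γ : ℂ → ℝ) (l k : ℕ) :
    Kcc γ (l + 1) (l + 1 + k) = ((l : ℝ) + 1) * (l + 1 + k) *
      ∫ z, γ z * (‖z‖ ^ (2 * l + k) * Real.cos (k * arg z)) ∂diskMeasure := by
  rw [Kcc, linearizedDtN, ← integral_const_mul]
  refine setIntegral_congr_fun isOpen_ball.measurableSet fun z hz => ?_
  have e : l + 1 + k = l + k + 1 := by ring
  simp only [e, gradient_harmonicExtension (isDirichletSolution_cos _) hz,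
    gradient_re_comp (hasDerivAt_pow_succ z _)]
  have h : inner ℝ (conj (((l : ℂ) + 1) * z ^ l)) (conj ((((l + k : ℕ) : ℂ) + 1) * z ^ (l + k)))
      = ((l : ℝ) + 1) * (l + 1 + k) * (‖z‖ ^ (2 * l + k) * Real.cos (k * arg z)) := by
    have h1 : ((l : ℂ) + 1) * z ^ l * conj ((((l + k : ℕ) : ℂ) + 1) * z ^ (l + k))
        = ((((l : ℝ) + 1) * (l + 1 + k) : ℝ) : ℂ) * (z ^ l * conj z ^ (l + k)) := by
      simp; ring
    rw [Complex.inner, conj_conj, mul_comm, h1, re_ofReal_mul, pow_mul_conj_pow, re_ofReal_mul,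
      conj_re, pow_re_eq]
    ring
  rw [h]
  ring

lemma Kcs_eq (γ : ℂ → ℝ) (l k : ℕ) :
    Kcs γ (l + 1) (l + 1 + k) = ((l : ℝ) + 1) * (l + 1 + k) *
      ∫ z, γ z * (‖z‖ ^ (2 * l + k) * Real.sin (k * arg z)) ∂diskMeasure := by
  rw [Kcs, linearizedDtN, ← integral_const_mul]
  refine setIntegral_congr_fun isOpen_ball.measurableSet fun z hz => ?_
  have e : l + 1 + k = l + k + 1 := by ring
  simp only [e, gradient_harmonicExtension (isDirichletSolution_cos _) hz,
    gradient_harmonicExtension (isDirichletSolution_sin _) hz,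
    gradient_re_comp (hasDerivAt_pow_succ z _), gradient_im_comp (hasDerivAt_pow_succ z _)]
  have h : inner ℝ (conj (((l : ℂ) + 1) * z ^ l))
        (I * conj ((((l + k : ℕ) : ℂ) + 1) * z ^ (l + k)))
      = ((l : ℝ) + 1) * (l + 1 + k) * (‖z‖ ^ (2 * l + k) * Real.sin (k * arg z)) := by
    have h1 : ((l : ℂ) + 1) * z ^ l * (I * conj ((((l + k : ℕ) : ℂ) + 1) * z ^ (l + k)))
        = ((((l : ℝ) + 1) * (l + 1 + k) : ℝ) : ℂ) * ((z ^ l * conj z ^ (l + k)) * I) := by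
      simp; ring
    rw [Complex.inner, conj_conj, mul_comm, h1, re_ofReal_mul, pow_mul_conj_pow, mul_assoc ((‖z‖ ^ (2 * l) : ℝ) : ℂ), re_ofReal_mul,
      mul_I_re, conj_im, neg_neg, pow_im_eq]
    ring
  rw [h]
  ring

/-! ### Radial orthogonality -/

open Polynomial in
-- The numerator of `mlCoeff k l n` is Q(l) for Q = ∏ (X + j + k + 1) of degree n, and its
-- denominator is the inverse of the nodal weight at the nodes 0, ..., n. The sum is thus the
-- barycentric form of Lagrange interpolation of Q, evaluated at -(m + k + 1). The right side
-- vanishes for m < n, which is the source of orthogonality.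
lemma sum_mlCoeff_div (k m n : ℕ) :
    ∑ l ∈ Finset.range (n + 1), mlCoeff k l n / ((l : ℝ) + m + k + 1) =
      (∏ j ∈ Finset.range n, ((m : ℝ) - j)) /
        ∏ j ∈ Finset.range (n + 1), ((m : ℝ) + k + 1 + j) := by
  classical
  set Q : ℝ[X] := ∏ j ∈ Finset.range n, (X + C ((j : ℝ) + k + 1)) with hQ
  have hdeg : Q.degree < (Finset.range (n + 1)).card := by
    rw [hQ, degree_prod]
    simp only [degree_X_add_C, Finset.sum_const, Finset.card_range, nsmul_eq_mul, mul_one]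
    exact_mod_cast Nat.lt_succ_self n
  have hinj : Set.InjOn (fun i : ℕ => (i : ℝ)) (Finset.range (n + 1) : Set ℕ) :=
    Nat.cast_injective.injOn
  set x : ℝ := -((m : ℝ) + k + 1) with hx
  have hxi : ∀ i ∈ Finset.range (n + 1), x ≠ ((i : ℕ) : ℝ) := by
    intro i _ h
    have : (0 : ℝ) ≤ i := Nat.cast_nonneg i
    have : (0 : ℝ) ≤ m := Nat.cast_nonneg m
    have : (0 : ℝ) ≤ k := Nat.cast_nonneg k
    linarith
  have key := congrArg (eval x) (Lagrange.eq_interpolate hinj hdeg)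
  rw [Lagrange.eval_interpolate_not_at_node _ hxi, Lagrange.eval_nodal] at key
  have hP : ∏ j ∈ Finset.range (n + 1), ((m : ℝ) + k + 1 + j) ≠ 0 :=
    Finset.prod_ne_zero_iff.2 fun j _ => by positivity
  have h1 : ∏ i ∈ Finset.range (n + 1), (x - (i : ℝ)) =
      (-1) ^ (n + 1) * ∏ j ∈ Finset.range (n + 1), ((m : ℝ) + k + 1 + j) := by
    rw [← Finset.card_range (n + 1), ← Finset.prod_const, Finset.card_range,
      ← Finset.prod_mul_distrib]
    exact Finset.prod_congr rfl fun i _ => by rw [hx]; ring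
  have h2 : eval x Q = (-1) ^ n * ∏ j ∈ Finset.range n, ((m : ℝ) - j) := by
    rw [hQ, eval_prod]
    conv_rhs => rw [← Finset.card_range n, ← Finset.prod_const, Finset.card_range,
      ← Finset.prod_mul_distrib]
    exact Finset.prod_congr rfl fun i _ => by simp [hx]; ring
  have h3 : ∑ i ∈ Finset.range (n + 1), Lagrange.nodalWeight (Finset.range (n + 1))
      (fun i : ℕ => (i : ℝ)) i * (x - (i : ℝ))⁻¹ * eval (i : ℝ) Q =
      - ∑ l ∈ Finset.range (n + 1), mlCoeff k l n / ((l : ℝ) + m + k + 1) := by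
    rw [← Finset.sum_neg_distrib]
    refine Finset.sum_congr rfl fun i _ => ?_
    have e1 : eval (i : ℝ) Q = ∏ j ∈ Finset.range n, ((i : ℝ) + j + k + 1) := by
      rw [hQ, eval_prod]
      exact Finset.prod_congr rfl fun j _ => by simp; ring
    have e2 : x - (i : ℝ) = -((i : ℝ) + m + k + 1) := by rw [hx]; ring
    rw [e1, e2, Lagrange.nodalWeight, mlCoeff, Finset.prod_inv_distrib, inv_neg]
    ring
  rw [h1, h2, h3] at key
  rw [eq_div_iff hP]
  have h4 : ((-1 : ℝ) ^ n) ≠ 0 := by simp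
  apply mul_left_cancel₀ h4
  rw [key]
  ring

/-- The factors with j < l give l!, those with j > l give (-1)^(n-l) (n-l)!. This matches the
coefficients of L^(k)_n with those in `recCoeff`. -/
lemma prod_erase_sub (l n : ℕ) (hl : l ≤ n) :
    ∏ j ∈ (Finset.range (n + 1)).erase l, ((l : ℝ) - j) =
      (-1) ^ (n - l) * (Nat.factorial l * Nat.factorial (n - l)) := by
  obtain ⟨d, rfl⟩ := Nat.exists_eq_add_of_le hl
  have h1 : (Finset.range (l + d + 1)).erase l =
      Finset.range l ∪ (Finset.range d).image (fun i => l + 1 + i) := by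
    ext j
    simp only [Finset.mem_erase, Finset.mem_range, Finset.mem_union, Finset.mem_image]
    constructor
    · rintro ⟨h1, h2⟩
      rcases lt_or_gt_of_ne h1 with h | h
      · exact Or.inl h
      · exact Or.inr ⟨j - (l + 1), by omega, by omega⟩
    · rintro (h | ⟨i, h, rfl⟩) <;> omega
  have h2 : Disjoint (Finset.range l) ((Finset.range d).image (fun i => l + 1 + i)) := by
    rw [Finset.disjoint_left]
    intro j hj hj'
    simp only [Finset.mem_range, Finset.mem_image] at hj hj'
    obtain ⟨i, _, rfl⟩ := hj'
    omega
  rw [h1, Finset.prod_union h2, Finset.prod_image (by intro a _ b _ h; simpa using h)]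
  have h3 : ∏ j ∈ Finset.range l, ((l : ℝ) - j) = Nat.factorial l := by
    rw [← Finset.prod_range_reflect, ← Finset.prod_range_add_one_eq_factorial]
    push_cast
    refine Finset.prod_congr rfl fun j hj => ?_
    have : j + 1 ≤ l := Finset.mem_range.1 hj
    have h : l - 1 - j = l - (j + 1) := by omega
    rw [h, Nat.cast_sub this]
    push_cast; ring
  have h4 : ∏ i ∈ Finset.range d, ((l : ℝ) - ((l + 1 + i : ℕ) : ℝ)) =
      (-1) ^ d * Nat.factorial d := by
    rw [← Finset.prod_range_add_one_eq_factorial]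
    conv_rhs => rw [← Finset.card_range d, ← Finset.prod_const, Finset.card_range]
    push_cast
    rw [← Finset.prod_mul_distrib]
    exact Finset.prod_congr rfl fun i _ => by ring
  rw [h3, h4, Nat.add_sub_cancel_left]
  ring

lemma mlCoeff_self (k n : ℕ) :
    mlCoeff k n n = (∏ j ∈ Finset.range n, ((n : ℝ) + j + k + 1)) / Nat.factorial n := by
  rw [mlCoeff, prod_erase_sub n n le_rfl]
  simp

lemma mlCoeff_self_ne_zero (k n : ℕ) : mlCoeff k n n ≠ 0 := by
  rw [mlCoeff_self]
  have : 0 < ∏ j ∈ Finset.range n, ((n : ℝ) + j + k + 1) :=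
    Finset.prod_pos fun j _ => by positivity
  positivity

lemma integral_muntzLegendre_mul_pow (k m n : ℕ) :
    ∫ r in (0 : ℝ)..1, muntzLegendre k n r * r ^ (2 * m + k) * r =
      (∏ j ∈ Finset.range n, ((m : ℝ) - j)) /
        (2 * ∏ j ∈ Finset.range (n + 1), ((m : ℝ) + k + 1 + j)) := by
  have h : ∀ r : ℝ, muntzLegendre k n r * r ^ (2 * m + k) * r =
      ∑ l ∈ Finset.range (n + 1), mlCoeff k l n * r ^ (2 * (l + m + k) + 1) := by
    intro r
    rw [muntzLegendre, Finset.sum_mul, Finset.sum_mul]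
    exact Finset.sum_congr rfl fun l _ => by ring
  simp_rw [h]
  rw [intervalIntegral.integral_finsetSum
    fun l _ => Continuous.intervalIntegrable (by fun_prop) _ _]
  rw [mul_comm (2 : ℝ), ← div_div, ← sum_mlCoeff_div, Finset.sum_div]
  refine Finset.sum_congr rfl fun l _ => ?_
  rw [intervalIntegral.integral_const_mul, integral_pow]
  push_cast
  have : (l : ℝ) + m + k + 1 ≠ 0 := by positivity
  have h2 : (2 : ℝ) * (l + m + k) + 1 + 1 ≠ 0 := by positivity
  field_simp
  simp
  ring

lemma integral_muntzLegendre_mul_of_lt (k : ℕ) {m n : ℕ} (h : m < n) :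
    ∫ r in (0 : ℝ)..1, muntzLegendre k n r * muntzLegendre k m r * r = 0 := by
  have e : ∀ r : ℝ, muntzLegendre k n r * muntzLegendre k m r * r =
      ∑ l ∈ Finset.range (m + 1),
        mlCoeff k l m * (muntzLegendre k n r * r ^ (2 * l + k) * r) := by
    intro r
    rw [muntzLegendre.eq_def k m, Finset.mul_sum, Finset.sum_mul]
    exact Finset.sum_congr rfl fun l _ => by ring
  have hc := continuous_muntzLegendre k n
  simp_rw [e]
  rw [intervalIntegral.integral_finsetSum
    fun l _ => Continuous.intervalIntegrable (by fun_prop) _ _]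
  refine Finset.sum_eq_zero fun l hl => ?_
  have hl' : l < n := lt_of_lt_of_le (Finset.mem_range.1 hl) h
  rw [intervalIntegral.integral_const_mul, integral_muntzLegendre_mul_pow,
    -- Since l < n, the factor with j = l vanishes.
    Finset.prod_eq_zero (Finset.mem_range.2 hl') (sub_self _)]
  simp

lemma integral_muntzLegendre_mul_of_ne (k : ℕ) {m n : ℕ} (h : m ≠ n) :
    ∫ r in (0 : ℝ)..1, muntzLegendre k n r * muntzLegendre k m r * r = 0 := by
  rcases lt_or_gt_of_ne h with h | h
  · exact integral_muntzLegendre_mul_of_lt k h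
  · simpa only [mul_comm (muntzLegendre k n _)] using integral_muntzLegendre_mul_of_lt k h

/-- Expanding one factor, only its leading term r^(2n+k) survives, by orthogonality to the lower
powers. -/
lemma integral_muntzLegendre_sq (k n : ℕ) :
    ∫ r in (0 : ℝ)..1, muntzLegendre k n r * muntzLegendre k n r * r =
      1 / (2 * (2 * n + k + 1)) := by
  have e : ∀ r : ℝ, muntzLegendre k n r * muntzLegendre k n r * r =
      ∑ l ∈ Finset.range (n + 1),
        mlCoeff k l n * (muntzLegendre k n r * r ^ (2 * l + k) * r) := by
    intro r
    conv_lhs => rw [muntzLegendre.eq_def k n, Finset.mul_sum, Finset.sum_mul]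
    exact Finset.sum_congr rfl fun l _ => by rw [muntzLegendre.eq_def k n]; ring
  have hc := continuous_muntzLegendre k n
  simp_rw [e]
  rw [intervalIntegral.integral_finsetSum
    fun l _ => Continuous.intervalIntegrable (by fun_prop) _ _, Finset.sum_range_succ,
    Finset.sum_eq_zero fun l hl => ?_, zero_add]
  · rw [intervalIntegral.integral_const_mul, integral_muntzLegendre_mul_pow, mlCoeff_self,
      Finset.prod_range_succ _ n]
    have h1 : ∏ j ∈ Finset.range n, ((n : ℝ) - j) = Nat.factorial n := by
      have := prod_erase_sub n n le_rfl
      rw [Finset.range_add_one, Finset.erase_insert Finset.notMem_range_self] at this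
      simpa using this
    have h2 : ∏ j ∈ Finset.range n, ((n : ℝ) + k + 1 + j) =
        ∏ j ∈ Finset.range n, ((n : ℝ) + j + k + 1) :=
      Finset.prod_congr rfl fun j _ => by ring
    have h3 : ∏ j ∈ Finset.range n, ((n : ℝ) + j + k + 1) ≠ 0 :=
      Finset.prod_ne_zero_iff.2 fun j _ => by positivity
    have h4 : (Nat.factorial n : ℝ) ≠ 0 := by positivity
    have h5 : (2 * n + k + 1 : ℝ) ≠ 0 := by positivity
    have h6 : (n + k + 1 + n : ℝ) ≠ 0 := by positivity
    rw [h1, h2]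
    field_simp
    ring
  · rw [intervalIntegral.integral_const_mul, integral_muntzLegendre_mul_pow,
      Finset.prod_eq_zero (Finset.mem_range.2 (Finset.mem_range.1 hl)) (sub_self _)]
    simp

/-! ### Orthogonality of the modes -/

lemma integral_disk_polar (F G : ℝ → ℝ) :
    ∫ z, F ‖z‖ * G (arg z) ∂diskMeasure =
      (∫ r in (0 : ℝ)..1, F r * r) * ∫ φ in (-π)..π, G φ := by
  rw [intervalIntegral.integral_of_le zero_le_one,
    intervalIntegral.integral_of_le (by linarith [Real.pi_pos]),
    integral_Ioc_eq_integral_Ioo, integral_Ioc_eq_integral_Ioo, diskMeasure,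
    ← integral_indicator (show MeasurableSet disk from Metric.isOpen_ball.measurableSet),
    ← Complex.integral_comp_polarCoord_symm, ← setIntegral_prod_mul]
  rw [← Measure.volume_eq_prod, ← integral_indicator (by measurability),
    ← integral_indicator (measurableSet_Ioo.prod measurableSet_Ioo)]
  congr 1
  ext ⟨r, φ⟩
  -- The two integrands agree pointwise: inside the polar chart the disk is the condition r < 1, and
  -- outside the chart both indicators vanish.
  by_cases h : (r, φ) ∈ polarCoord.target
  · have h' := h
    simp only [polarCoord_target, Set.mem_prod, Set.mem_Ioi] at h'
    have hn : ‖Complex.polarCoord.symm (r, φ)‖ = r := by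
      rw [Complex.norm_polarCoord_symm, abs_of_pos h'.1]
    have ha : arg (Complex.polarCoord.symm (r, φ)) = φ := by
      rw [Complex.polarCoord_symm_apply, ofReal_cos, ofReal_sin]
      exact arg_mul_cos_add_sin_mul_I h'.1 ⟨h'.2.1, h'.2.2.le⟩
    rw [Set.indicator_of_mem h]
    by_cases h1 : r < 1
    · rw [Set.indicator_of_mem (show Complex.polarCoord.symm (r, φ) ∈ disk by
          simpa [disk, abs_of_pos h'.1] using h1),
        Set.indicator_of_mem (show (r, φ) ∈ Set.Ioo (0 : ℝ) 1 ×ˢ Set.Ioo (-π) π from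
          ⟨⟨h'.1, h1⟩, h'.2⟩), hn, ha]
      simp; ring
    · rw [Set.indicator_of_notMem (show Complex.polarCoord.symm (r, φ) ∉ disk by
          simpa [disk, abs_of_pos h'.1] using h1),
        Set.indicator_of_notMem (show (r, φ) ∉ Set.Ioo (0 : ℝ) 1 ×ˢ Set.Ioo (-π) π from
          fun h => h1 h.1.2)]
      simp
  · rw [Set.indicator_of_notMem h, Set.indicator_of_notMem]
    intro h2
    exact h (by simpa [polarCoord_target] using ⟨h2.1.1, h2.2⟩)

lemma integral_cos_int_mul (m : ℤ) (hm : m ≠ 0) : ∫ φ in (-π)..π, Real.cos (m * φ) = 0 := by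
  have hm' : (m : ℝ) ≠ 0 := by exact_mod_cast hm
  rw [intervalIntegral.integral_comp_mul_left _ hm', integral_cos]
  simp [Real.sin_int_mul_pi]

lemma integral_cos_mul_cos {j k : ℕ} (h : j ≠ k) :
    ∫ φ in (-π)..π, Real.cos (j * φ) * Real.cos (k * φ) = 0 := by
  have e : ∀ φ : ℝ, Real.cos (j * φ) * Real.cos (k * φ) =
      (Real.cos (((j - k : ℤ) : ℝ) * φ) + Real.cos (((j + k : ℤ) : ℝ) * φ)) / 2 := by
    intro φ
    push_cast
    rw [sub_mul, add_mul, Real.cos_add, Real.cos_sub]; ring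
  simp_rw [e]
  rw [intervalIntegral.integral_div, intervalIntegral.integral_add
    (Continuous.intervalIntegrable (by fun_prop) _ _)
    (Continuous.intervalIntegrable (by fun_prop) _ _),
    integral_cos_int_mul _ (by omega), integral_cos_int_mul _ (by omega)]
  simp

lemma integral_sin_mul_sin {j k : ℕ} (h : j ≠ k) :
    ∫ φ in (-π)..π, Real.sin (j * φ) * Real.sin (k * φ) = 0 := by
  have e : ∀ φ : ℝ, Real.sin (j * φ) * Real.sin (k * φ) =
      (Real.cos (((j - k : ℤ) : ℝ) * φ) - Real.cos (((j + k : ℤ) : ℝ) * φ)) / 2 := by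
    intro φ
    push_cast
    rw [sub_mul, add_mul, Real.cos_add, Real.cos_sub]; ring
  simp_rw [e]
  rw [intervalIntegral.integral_div, intervalIntegral.integral_sub
    (Continuous.intervalIntegrable (by fun_prop) _ _)
    (Continuous.intervalIntegrable (by fun_prop) _ _),
    integral_cos_int_mul _ (by omega), integral_cos_int_mul _ (by omega)]
  simp

lemma integral_cos_mul_sin (j k : ℕ) :
    ∫ φ in (-π)..π, Real.cos (j * φ) * Real.sin (k * φ) = 0 := by
  have h := intervalIntegral.integral_comp_neg (a := -π) (b := π)
    (fun φ => Real.cos (j * φ) * Real.sin (k * φ))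
  simp only [mul_neg, Real.cos_neg, Real.sin_neg, intervalIntegral.integral_neg, neg_neg] at h
  linarith

lemma integral_cos_sq_succ (k : ℕ) :
    ∫ φ in (-π)..π, Real.cos ((k + 1 : ℕ) * φ) * Real.cos ((k + 1 : ℕ) * φ) = π := by
  have e : ∀ φ : ℝ, Real.cos ((k + 1 : ℕ) * φ) * Real.cos ((k + 1 : ℕ) * φ) =
      (1 + Real.cos (((2 * (k + 1) : ℤ) : ℝ) * φ)) / 2 := by
    intro φ
    have : ((2 * (k + 1) : ℤ) : ℝ) * φ = 2 * ((k + 1 : ℕ) * φ) := by push_cast; ring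
    rw [this, Real.cos_two_mul]; ring
  simp_rw [e]
  rw [intervalIntegral.integral_div, intervalIntegral.integral_add
    (Continuous.intervalIntegrable (by fun_prop) _ _)
    (Continuous.intervalIntegrable (by fun_prop) _ _),
    integral_cos_int_mul _ (by omega)]
  simp

lemma integral_sin_sq_succ (k : ℕ) :
    ∫ φ in (-π)..π, Real.sin ((k + 1 : ℕ) * φ) * Real.sin ((k + 1 : ℕ) * φ) = π := by
  have e : ∀ φ : ℝ, Real.sin ((k + 1 : ℕ) * φ) * Real.sin ((k + 1 : ℕ) * φ) =
      1 - Real.cos ((k + 1 : ℕ) * φ) * Real.cos ((k + 1 : ℕ) * φ) := by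
    intro φ
    have := Real.sin_sq_add_cos_sq ((k + 1 : ℕ) * φ)
    linarith
  simp_rw [e]
  rw [intervalIntegral.integral_sub
    (Continuous.intervalIntegrable (by fun_prop) _ _)
    (Continuous.intervalIntegrable (by fun_prop) _ _), integral_cos_sq_succ]
  simp

lemma inner_toLp {f g : ℂ → ℝ} (hf : MemLp f 2 diskMeasure) (hg : MemLp g 2 diskMeasure) :
    inner ℝ (hf.toLp f) (hg.toLp g) = ∫ z, g z * f z ∂diskMeasure := by
  rw [L2.inner_def]
  refine integral_congr_ae ?_
  filter_upwards [hf.coeFn_toLp, hg.coeFn_toLp] with z h1 h2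
  rw [h1, h2]
  simp

lemma inner_radial_mul {L M f g : ℝ → ℝ}
    (h1 : MemLp (fun z : ℂ => L ‖z‖ * f (arg z)) 2 diskMeasure)
    (h2 : MemLp (fun z : ℂ => M ‖z‖ * g (arg z)) 2 diskMeasure) :
    inner ℝ (h1.toLp _) (h2.toLp _) =
      (∫ r in (0 : ℝ)..1, M r * L r * r) * ∫ φ in (-π)..π, g φ * f φ := by
  rw [inner_toLp, ← integral_disk_polar]
  refine integral_congr_ae (Filter.Eventually.of_forall fun z => ?_)
  simp only
  ring

lemma inner_cosMode (j k m n : ℕ) : inner ℝ (cosMode j m) (cosMode k n) =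
    (∫ r in (0 : ℝ)..1, muntzLegendre k n r * muntzLegendre j m r * r) *
      ∫ φ in (-π)..π, Real.cos (k * φ) * Real.cos (j * φ) :=
  inner_radial_mul (f := fun φ => Real.cos (j * φ)) (g := fun φ => Real.cos (k * φ)) _ _

lemma inner_sinMode (j k m n : ℕ) : inner ℝ (sinMode j m) (sinMode k n) =
    (∫ r in (0 : ℝ)..1, muntzLegendre k n r * muntzLegendre j m r * r) *
      ∫ φ in (-π)..π, Real.sin (k * φ) * Real.sin (j * φ) :=
  inner_radial_mul (f := fun φ => Real.sin (j * φ)) (g := fun φ => Real.sin (k * φ)) _ _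

lemma inner_sinMode_cosMode (j k m n : ℕ) : inner ℝ (sinMode j m) (cosMode k n) = 0 := by
  have h : inner ℝ (sinMode j m) (cosMode k n) =
    (∫ r in (0 : ℝ)..1, muntzLegendre k n r * muntzLegendre j m r * r) *
      ∫ φ in (-π)..π, Real.cos (k * φ) * Real.sin (j * φ) :=
    inner_radial_mul (f := fun φ => Real.sin (j * φ)) (g := fun φ => Real.cos (k * φ)) _ _
  rw [h, integral_cos_mul_sin, mul_zero]

lemma inner_cosMode_of_ne {j k m n : ℕ} (h : (j, m) ≠ (k, n)) :
    inner ℝ (cosMode j m) (cosMode k n) = 0 := by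
  rw [inner_cosMode]
  by_cases hjk : k = j
  · subst hjk
    rw [integral_muntzLegendre_mul_of_ne _ (by simpa using h), zero_mul]
  · rw [integral_cos_mul_cos hjk, mul_zero]

lemma inner_sinMode_of_ne {j k m n : ℕ} (h : (j, m) ≠ (k, n)) :
    inner ℝ (sinMode j m) (sinMode k n) = 0 := by
  rw [inner_sinMode]
  by_cases hjk : k = j
  · subst hjk
    rw [integral_muntzLegendre_mul_of_ne _ (by simpa using h), zero_mul]
  · rw [integral_sin_mul_sin hjk, mul_zero]

/-- The angular integral is 2π here, against π for positive frequency; this is where the factor 1/2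
in the k = 0 series comes from. -/
lemma norm_sq_cosMode_zero (n : ℕ) : ‖cosMode 0 n‖ ^ 2 = π / (2 * n + 1) := by
  rw [← real_inner_self_eq_norm_sq, inner_cosMode, integral_muntzLegendre_sq]
  have : (2 * n + 1 : ℝ) ≠ 0 := by positivity
  simp
  field_simp
  ring

lemma norm_sq_cosMode_succ (k n : ℕ) :
    ‖cosMode (k + 1) n‖ ^ 2 = π / (2 * (2 * n + (k + 1 : ℕ) + 1)) := by
  rw [← real_inner_self_eq_norm_sq, inner_cosMode, integral_muntzLegendre_sq,
    integral_cos_sq_succ]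
  ring

lemma norm_sq_sinMode_succ (k n : ℕ) :
    ‖sinMode (k + 1) n‖ ^ 2 = π / (2 * (2 * n + (k + 1 : ℕ) + 1)) := by
  rw [← real_inner_self_eq_norm_sq, inner_sinMode, integral_muntzLegendre_sq,
    integral_sin_sq_succ]
  ring

/-! ### The reconstruction coefficients as inner products -/

/-- The factors (l+1)(l+1+k) cancel, and the remaining weights on the moments are 2(2n+k+1)/π times
the coefficients of L^(k)_n. A general angular factor g covers cosine and sine at once. -/
lemma recCoeff_eq {γ : ℂ → ℝ} (hγ : MemLp γ 2 diskMeasure) {K : ℕ → ℕ → ℝ} {g : ℝ → ℝ}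
    (hg : Measurable g) (hg1 : ∀ x, |g x| ≤ 1) {k : ℕ}
    (hK : ∀ l : ℕ, K (l + 1) (l + 1 + k) = ((l : ℝ) + 1) * (l + 1 + k) *
      ∫ z, γ z * (‖z‖ ^ (2 * l + k) * g (arg z)) ∂diskMeasure) (n : ℕ) :
    recCoeff K n k = 2 * (2 * n + k + 1) / π *
      ∫ z, γ z * (muntzLegendre k n ‖z‖ * g (arg z)) ∂diskMeasure := by
  have hint : ∀ l : ℕ, Integrable (fun z => γ z * (‖z‖ ^ (2 * l + k) * g (arg z))) diskMeasure :=
    fun l => hγ.integrable_mul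
      (memLp_radial_mul (L := fun r => r ^ (2 * l + k)) (by fun_prop) hg hg1)
  have e : ∀ z : ℂ, γ z * (muntzLegendre k n ‖z‖ * g (arg z)) =
      ∑ l ∈ Finset.range (n + 1),
        mlCoeff k l n * (γ z * (‖z‖ ^ (2 * l + k) * g (arg z))) := by
    intro z
    rw [muntzLegendre, Finset.sum_mul, Finset.mul_sum]
    exact Finset.sum_congr rfl fun l _ => by ring
  simp_rw [e]
  rw [integral_finsetSum _ fun l _ => (hint l).const_mul _, recCoeff, Finset.mul_sum]
  refine Finset.sum_congr rfl fun l hl => ?_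
  have hl' : l ≤ n := Nat.lt_succ_iff.1 (Finset.mem_range.1 hl)
  rw [integral_const_mul, hK, mlCoeff, prod_erase_sub l n hl']
  have h1 : ∏ j ∈ Finset.range n, (1 + (k : ℝ) + (l + j)) =
      ∏ j ∈ Finset.range n, ((l : ℝ) + j + k + 1) :=
    Finset.prod_congr rfl fun j _ => by ring
  have h2 : (-1 : ℝ) ^ (n - l) * (-1) ^ (n - l) = 1 := by
    rw [← mul_pow]; simp
  have h3 : (l + 1 + k : ℝ) ≠ 0 := by positivity
  have h4 : (l + 1 : ℝ) ≠ 0 := by positivity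
  have h5 : ((-1 : ℝ) ^ (n - l))⁻¹ = (-1) ^ (n - l) := inv_eq_of_mul_eq_one_right h2
  rw [h1, div_eq_mul_inv _ ((-1 : ℝ) ^ (n - l) * _), mul_inv, h5]
  field_simp

lemma recCoeff_Kcc {γ : ℂ → ℝ} (hγ : MemLp γ 2 diskMeasure) (k n : ℕ) :
    recCoeff (Kcc γ) n k =
      2 * (2 * n + k + 1) / π * inner ℝ (cosMode k n) (hγ.toLp γ) := by
  rw [cosMode, inner_toLp]
  exact recCoeff_eq (g := fun φ => Real.cos (k * φ)) hγ (by fun_prop)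
    (fun _ => Real.abs_cos_le_one _) (fun l => Kcc_eq γ l k) n

lemma recCoeff_Kcs {γ : ℂ → ℝ} (hγ : MemLp γ 2 diskMeasure) (k n : ℕ) :
    recCoeff (Kcs γ) n k =
      2 * (2 * n + k + 1) / π * inner ℝ (sinMode k n) (hγ.toLp γ) := by
  rw [sinMode, inner_toLp]
  exact recCoeff_eq (g := fun φ => Real.sin (k * φ)) hγ (by fun_prop)
    (fun _ => Real.abs_sin_le_one _) (fun l => Kcs_eq γ l k) n

/-! ### Completeness of the modes -/

/-- Stone–Weierstrass on the closed disk: the star algebra generated by z is dense, and it is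
spanned by the products z^a conj(z)^b. -/
lemma exists_span_monomial_approx {g : ℂ → ℂ} (hg : Continuous g) {ε : ℝ} (hε : 0 < ε) :
    ∃ P ∈ Submodule.span ℂ (Set.range fun ab : ℕ × ℕ => fun z : ℂ => z ^ ab.1 * conj z ^ ab.2),
      ∀ z ∈ closedBall (0 : ℂ) 1, ‖g z - P z‖ ≤ ε := by
  have : CompactSpace (closedBall (0 : ℂ) 1) :=
    isCompact_iff_compactSpace.1 (isCompact_closedBall 0 1)
  set G : C(closedBall (0 : ℂ) 1, ℂ) := ⟨fun z => g z, by fun_prop⟩ with hG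
  have h1 : G ∈ StarAlgebra.elemental ℂ
      (ContinuousMap.restrict (closedBall (0 : ℂ) 1) (.id ℂ)) := by
    rw [ContinuousMap.elemental_id_eq_top]; trivial
  have h2 : G ∈ closure (StarAlgebra.adjoin ℂ
      {ContinuousMap.restrict (closedBall (0 : ℂ) 1) (.id ℂ)} : Set C(closedBall (0 : ℂ) 1, ℂ)) :=
    h1
  obtain ⟨Q, hQ, hd⟩ := Metric.mem_closure_iff.1 h2 ε hε
  have h3 : Q ∈ Submodule.span ℂ (Submonoid.closure
      ({ContinuousMap.restrict (closedBall (0 : ℂ) 1) (.id ℂ)} ∪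
        star {ContinuousMap.restrict (closedBall (0 : ℂ) 1) (.id ℂ)}) :
        Set C(closedBall (0 : ℂ) 1, ℂ)) := by
    rw [← StarAlgebra.adjoin_eq_span]; exact hQ
  have h4 : ∃ P ∈ Submodule.span ℂ
      (Set.range fun ab : ℕ × ℕ => fun z : ℂ => z ^ ab.1 * conj z ^ ab.2),
      ∀ z : closedBall (0 : ℂ) 1, Q z = P z := by
    clear hd hQ
    induction h3 using Submodule.span_induction with
    | mem q hq =>
      rw [Set.star_singleton, Set.singleton_union, SetLike.mem_coe,
        Submonoid.mem_closure_pair] at hq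
      obtain ⟨a, b, rfl⟩ := hq
      exact ⟨_, Submodule.subset_span ⟨(a, b), rfl⟩, fun z => by simp⟩
    | zero => exact ⟨0, Submodule.zero_mem _, fun z => by simp⟩
    | add p q _ _ hp hq =>
      obtain ⟨P, hP, hP'⟩ := hp
      obtain ⟨R, hR, hR'⟩ := hq
      exact ⟨P + R, Submodule.add_mem _ hP hR, fun z => by simp [hP', hR']⟩
    | smul c p _ hp =>
      obtain ⟨P, hP, hP'⟩ := hp
      exact ⟨c • P, Submodule.smul_mem _ c hP, fun z => by simp [hP']⟩
  obtain ⟨P, hP, hP'⟩ := h4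
  refine ⟨P, hP, fun z hz => ?_⟩
  have h5 := ContinuousMap.dist_apply_le_dist (f := G) (g := Q) ⟨z, hz⟩
  rw [hP', dist_eq_norm] at h5
  exact h5.trans hd.le

lemma continuous_of_mem_span_monomial {P : ℂ → ℂ}
    (hP : P ∈ Submodule.span ℂ
      (Set.range fun ab : ℕ × ℕ => fun z : ℂ => z ^ ab.1 * conj z ^ ab.2)) : Continuous P := by
  induction hP using Submodule.span_induction with
  | mem q hq =>
    obtain ⟨ab, rfl⟩ := hq
    fun_prop
  | zero => exact continuous_const
  | add p q _ _ hp hq => exact hp.add hq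
  | smul c p _ hp => exact hp.const_smul c

lemma integrable_mul_continuous {f : ℂ → ℂ} (hf : Integrable f diskMeasure) {g : ℂ → ℂ}
    (hg : Continuous g) : Integrable (fun z => f z * g z) diskMeasure := by
  obtain ⟨C, hC⟩ := (isCompact_closedBall (0 : ℂ) 1).exists_bound_of_continuousOn
    hg.continuousOn
  refine hf.mul_bdd hg.aestronglyMeasurable (c := C) ?_
  refine (ae_restrict_iff' isOpen_ball.measurableSet).2 (Filter.Eventually.of_forall ?_)
  exact fun z hz => hC z (ball_subset_closedBall hz)

/-- Vanishing passes by linearity to polynomials in z and conj z, by uniform approximation to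
continuous functions, and in particular to smooth test functions supported in the disk. -/
lemma ae_eq_zero_of_integral_monomial_eq_zero {f : ℂ → ℂ} (hf : Integrable f diskMeasure)
    (h : ∀ a b : ℕ, ∫ z, f z * (z ^ a * conj z ^ b) ∂diskMeasure = 0) :
    f =ᵐ[diskMeasure] 0 := by
  have hspan : ∀ P ∈ Submodule.span ℂ
      (Set.range fun ab : ℕ × ℕ => fun z : ℂ => z ^ ab.1 * conj z ^ ab.2),
      ∫ z, f z * P z ∂diskMeasure = 0 := by
    intro P hP
    induction hP using Submodule.span_induction with
    | mem q hq =>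
      obtain ⟨ab, rfl⟩ := hq
      exact h _ _
    | zero => simp
    | add p q hp hq hp' hq' =>
      simp only [Pi.add_apply, mul_add]
      rw [integral_add (integrable_mul_continuous hf (continuous_of_mem_span_monomial hp))
        (integrable_mul_continuous hf (continuous_of_mem_span_monomial hq)), hp', hq', add_zero]
    | smul c p _ hp =>
      simp only [Pi.smul_apply, smul_eq_mul, mul_left_comm _ c]
      rw [integral_const_mul, hp, mul_zero]
  have hcont : ∀ g : ℂ → ℂ, Continuous g → ∫ z, f z * g z ∂diskMeasure = 0 := by
    intro g hg
    rw [← norm_le_zero_iff]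
    refine le_of_forall_pos_le_add fun ε hε => ?_
    set A := ∫ z, ‖f z‖ ∂diskMeasure with hA
    have hA0 : 0 ≤ A := integral_nonneg fun z => norm_nonneg _
    -- The error is at most A · ε/(A + 1) ≤ ε; the added 1 covers A = 0.
    obtain ⟨P, hP, hP'⟩ := exists_span_monomial_approx hg (ε := ε / (A + 1)) (by positivity)
    have hPc := continuous_of_mem_span_monomial hP
    have e : ∫ z, f z * g z ∂diskMeasure = ∫ z, f z * (g z - P z) ∂diskMeasure := by
      simp only [mul_sub]
      rw [integral_sub (integrable_mul_continuous hf hg) (integrable_mul_continuous hf hPc),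
        hspan P hP, sub_zero]
    rw [e, zero_add]
    calc ‖∫ z, f z * (g z - P z) ∂diskMeasure‖
        ≤ ∫ z, ‖f z‖ * (ε / (A + 1)) ∂diskMeasure := by
          refine norm_integral_le_of_norm_le (hf.norm.mul_const _) ?_
          refine (ae_restrict_iff' isOpen_ball.measurableSet).2 (Filter.Eventually.of_forall ?_)
          intro z hz
          rw [norm_mul]
          exact mul_le_mul_of_nonneg_left (hP' z (ball_subset_closedBall hz)) (norm_nonneg _)
      _ = A * (ε / (A + 1)) := by rw [integral_mul_const]
      _ ≤ ε := by
          rw [← mul_div_assoc, div_le_iff₀ (by positivity)]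
          nlinarith
  refine (ae_restrict_iff' isOpen_ball.measurableSet).2 ?_
  refine (isOpen_ball (x := (0 : ℂ)) (ε := 1)).ae_eq_zero_of_integral_contDiff_smul_eq_zero
    (IntegrableOn.locallyIntegrableOn hf) fun g hg _ hgs => ?_
  rw [← hcont (fun z => (g z : ℂ)) (by have := hg.continuous; fun_prop), diskMeasure,
    setIntegral_eq_integral_of_forall_compl_eq_zero]
  · exact integral_congr_ae (Filter.Eventually.of_forall fun z => by simp [mul_comm])
  · intro z hz
    have : z ∉ tsupport g := fun h => hz (hgs h)
    simp [image_eq_zero_of_notMem_tsupport this]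

/-- The passage from powers to L^(k)_n is triangular with nonzero diagonal, so it is inverted by
strong induction on n. -/
lemma integral_pow_mul_eq_zero {f : ℂ → ℝ} (hf : MemLp f 2 diskMeasure) {g : ℝ → ℝ}
    (hg : Measurable g) (hg1 : ∀ x, |g x| ≤ 1) {k : ℕ}
    (h : ∀ n : ℕ, ∫ z, f z * (muntzLegendre k n ‖z‖ * g (arg z)) ∂diskMeasure = 0) (n : ℕ) :
    ∫ z, f z * (‖z‖ ^ (2 * n + k) * g (arg z)) ∂diskMeasure = 0 := by
  have hint : ∀ l : ℕ, Integrable (fun z => f z * (‖z‖ ^ (2 * l + k) * g (arg z))) diskMeasure :=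
    fun l => hf.integrable_mul
      (memLp_radial_mul (L := fun r => r ^ (2 * l + k)) (by fun_prop) hg hg1)
  induction n using Nat.strong_induction_on with
  | _ n ih =>
    have e : ∀ z : ℂ, f z * (muntzLegendre k n ‖z‖ * g (arg z)) =
        ∑ l ∈ Finset.range (n + 1),
          mlCoeff k l n * (f z * (‖z‖ ^ (2 * l + k) * g (arg z))) := by
      intro z
      rw [muntzLegendre, Finset.sum_mul, Finset.mul_sum]
      exact Finset.sum_congr rfl fun l _ => by ring
    have h1 := h n
    simp_rw [e] at h1
    rw [integral_finsetSum _ fun l _ => (hint l).const_mul _, Finset.sum_range_succ,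
      Finset.sum_eq_zero, zero_add, integral_const_mul] at h1
    · exact (mul_eq_zero.1 h1).resolve_left (mlCoeff_self_ne_zero k n)
    · intro l hl
      rw [integral_const_mul, ih l (Finset.mem_range.1 hl), mul_zero]

lemma ae_eq_zero_of_orthogonal_modes {f : ℂ → ℝ} (hf : MemLp f 2 diskMeasure)
    (hc : ∀ k n : ℕ,
      ∫ z, f z * (muntzLegendre k n ‖z‖ * Real.cos (k * arg z)) ∂diskMeasure = 0)
    (hs : ∀ k n : ℕ,
      ∫ z, f z * (muntzLegendre k n ‖z‖ * Real.sin (k * arg z)) ∂diskMeasure = 0) :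
    f =ᵐ[diskMeasure] 0 := by
  have hfi : Integrable (fun z => (f z : ℂ)) diskMeasure :=
    (hf.integrable (by norm_num)).ofReal
  have hmon : ∀ k n : ℕ,
      ∫ z, (f z : ℂ) * (((‖z‖ ^ (2 * n) : ℝ) : ℂ) * z ^ k) ∂diskMeasure = 0 := by
    intro k n
    have h1 : ∀ z : ℂ, (f z : ℂ) * (((‖z‖ ^ (2 * n) : ℝ) : ℂ) * z ^ k) =
        ((f z * (‖z‖ ^ (2 * n + k) * Real.cos (k * arg z)) : ℝ) : ℂ) +
          ((f z * (‖z‖ ^ (2 * n + k) * Real.sin (k * arg z)) : ℝ) : ℂ) * I := by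
      intro z
      conv_lhs => rw [← re_add_im (z ^ k), pow_re_eq, pow_im_eq]
      push_cast
      ring
    have hci := hf.integrable_mul (memLp_radial_mul (L := fun r => r ^ (2 * n + k))
      (g := fun φ => Real.cos (k * φ)) (by fun_prop) (by fun_prop)
      fun _ => Real.abs_cos_le_one _)
    have hsi := hf.integrable_mul (memLp_radial_mul (L := fun r => r ^ (2 * n + k))
      (g := fun φ => Real.sin (k * φ)) (by fun_prop) (by fun_prop)
      fun _ => Real.abs_sin_le_one _)
    have h2 := integral_pow_mul_eq_zero hf (g := fun φ => Real.cos (k * φ)) (by fun_prop)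
      (fun _ => Real.abs_cos_le_one _) (hc k) n
    have h3 := integral_pow_mul_eq_zero hf (g := fun φ => Real.sin (k * φ)) (by fun_prop)
      (fun _ => Real.abs_sin_le_one _) (hs k) n
    simp_rw [h1]
    rw [integral_add hci.ofReal (hsi.ofReal.mul_const _), integral_mul_const,
      integral_complex_ofReal, integral_complex_ofReal]
    simp only [h2, h3]
    simp
  have hz : (fun z => (f z : ℂ)) =ᵐ[diskMeasure] 0 := by
    refine ae_eq_zero_of_integral_monomial_eq_zero hfi fun a b => ?_
    -- With k = |a - b|, the monomial is r^(2 min(a,b)) times z^k or its conjugate. As f is real,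
    -- the conjugate case follows by conjugating the integral.
    rcases le_total a b with hab | hab
    · obtain ⟨k, rfl⟩ := Nat.exists_eq_add_of_le hab
      rw [← map_zero (starRingEnd ℂ), ← hmon k a, ← integral_conj]
      simp_rw [pow_mul_conj_pow]
      simp
    · obtain ⟨k, rfl⟩ := Nat.exists_eq_add_of_le hab
      rw [← hmon k b]
      refine integral_congr_ae (Filter.Eventually.of_forall fun z => ?_)
      have := congrArg conj (pow_mul_conj_pow z b k)
      simp only [map_mul, map_pow, conj_conj, conj_ofReal] at this
      simp only
      rw [mul_comm (z ^ (b + k)), this]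
  filter_upwards [hz] with z h
  simpa using h

/-! ### Expansion in a complete orthogonal family -/

/-- Normalising gives an orthonormal family whose span has trivial orthogonal complement, that is, a
Hilbert basis; the two factors ‖v i‖⁻¹ combine into the division by ‖v i‖². -/
lemma hasSum_of_orthogonal_of_complete {ι E : Type*} [NormedAddCommGroup E]
    [InnerProductSpace ℝ E] [CompleteSpace E] {v : ι → E} (hv0 : ∀ i, v i ≠ 0)
    (hv : Pairwise fun i j => inner ℝ (v i) (v j) = 0)
    (hc : ∀ x : E, (∀ i, inner ℝ (v i) x = 0) → x = 0) (x : E) :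
    HasSum (fun i => (inner ℝ (v i) x / ‖v i‖ ^ 2) • v i) x := by
  have hon : Orthonormal ℝ fun i => (‖v i‖⁻¹ : ℝ) • v i := by
    refine ⟨fun i => ?_, fun i j hij => ?_⟩
    · rw [norm_smul, norm_inv, norm_norm, inv_mul_cancel₀ (norm_ne_zero_iff.2 (hv0 i))]
    · simp only
      rw [real_inner_smul_left, real_inner_smul_right, hv hij, mul_zero, mul_zero]
  have hbot : (Submodule.span ℝ (Set.range fun i => (‖v i‖⁻¹ : ℝ) • v i))ᗮ = ⊥ := by
    rw [Submodule.eq_bot_iff]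
    intro y hy
    refine hc y fun i => ?_
    have h1 := (Submodule.mem_orthogonal _ _).1 hy _ (Submodule.subset_span ⟨i, rfl⟩)
    simp only at h1
    rw [real_inner_smul_left] at h1
    exact (mul_eq_zero.1 h1).resolve_left (inv_ne_zero (norm_ne_zero_iff.2 (hv0 i)))
  have h := (HilbertBasis.mkOfOrthogonalEqBot hon hbot).hasSum_repr x
  convert! h using 2 with i
  rw [HilbertBasis.repr_apply_apply, HilbertBasis.coe_mkOfOrthogonalEqBot, smul_smul,
    real_inner_smul_left]
  congr 1
  ring

/-- The complete orthogonal family of modes. -/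
noncomputable def mode : ℕ ⊕ (ℕ × ℕ) ⊕ (ℕ × ℕ) → Lp ℝ 2 diskMeasure :=
  Sum.elim (cosMode 0) (Sum.elim (fun kn => cosMode (kn.1 + 1) kn.2)
    (fun kn => sinMode (kn.1 + 1) kn.2))

lemma mode_ne_zero (i : ℕ ⊕ (ℕ × ℕ) ⊕ (ℕ × ℕ)) : mode i ≠ 0 := by
  have hpi := Real.pi_pos
  have key : 0 < ‖mode i‖ ^ 2 := by
    rcases i with n | ⟨k, n⟩ | ⟨k, n⟩
    · exact (norm_sq_cosMode_zero n).symm ▸ by positivity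
    · exact (norm_sq_cosMode_succ k n).symm ▸ by positivity
    · exact (norm_sq_sinMode_succ k n).symm ▸ by positivity
  intro h
  simp [h] at key

lemma pairwise_inner_mode : Pairwise fun i j => inner ℝ (mode i) (mode j) = 0 := by
  rintro (m | ⟨j, m⟩ | ⟨j, m⟩) (n | ⟨k, n⟩ | ⟨k, n⟩) h
  · exact inner_cosMode_of_ne (by simpa using h)
  · exact inner_cosMode_of_ne (by simp)
  · exact (real_inner_comm _ _).trans (inner_sinMode_cosMode _ _ _ _)
  · exact inner_cosMode_of_ne (by simp)
  · exact inner_cosMode_of_ne (by simpa using h)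
  · exact (real_inner_comm _ _).trans (inner_sinMode_cosMode _ _ _ _)
  · exact inner_sinMode_cosMode _ _ _ _
  · exact inner_sinMode_cosMode _ _ _ _
  · exact inner_sinMode_of_ne (by simpa using h)

lemma eq_zero_of_inner_mode_eq_zero (x : Lp ℝ 2 diskMeasure)
    (h : ∀ i, inner ℝ (mode i) x = 0) : x = 0 := by
  have hx := Lp.memLp x
  have hx' : hx.toLp x = x := Lp.toLp_coeFn x hx
  rw [Lp.eq_zero_iff_ae_eq_zero]
  refine ae_eq_zero_of_orthogonal_modes hx (fun k n => ?_) (fun k n => ?_)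
  · rw [← inner_toLp (memLp_cosMode k n) hx, hx']
    rcases k with _ | k
    · exact h (.inl n)
    · exact h (.inr (.inl (k, n)))
  · rcases k with _ | k
    -- The sine mode of frequency 0 is identically zero, hence absent from `mode`.
    · simp
    · rw [← inner_toLp (memLp_sinMode (k + 1) n) hx, hx']
      exact h (.inr (.inr (k, n)))

end DiskEIT

/-! ### Assembly of the reconstruction formula -/

theorem mainTheorem1 (γ : ℂ → ℝ) (hγ : MemLp γ 2 DiskEIT.diskMeasure) :
    Summable (fun n : ℕ =>
      DiskEIT.recCoeff (DiskEIT.Kcc γ) n 0 • DiskEIT.cosMode 0 n) ∧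
    Summable (fun kn : ℕ × ℕ =>
      DiskEIT.recCoeff (DiskEIT.Kcc γ) kn.2 (kn.1 + 1) • DiskEIT.cosMode (kn.1 + 1) kn.2) ∧
    Summable (fun kn : ℕ × ℕ =>
      DiskEIT.recCoeff (DiskEIT.Kcs γ) kn.2 (kn.1 + 1) • DiskEIT.sinMode (kn.1 + 1) kn.2) ∧
    hγ.toLp γ =
      (1 / 2 : ℝ) • (∑' n : ℕ, DiskEIT.recCoeff (DiskEIT.Kcc γ) n 0 • DiskEIT.cosMode 0 n) +
      (∑' k : ℕ, ∑' n : ℕ,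
        DiskEIT.recCoeff (DiskEIT.Kcc γ) n (k + 1) • DiskEIT.cosMode (k + 1) n) +
      (∑' k : ℕ, ∑' n : ℕ,
        DiskEIT.recCoeff (DiskEIT.Kcs γ) n (k + 1) • DiskEIT.sinMode (k + 1) n) := by
  have hsum := DiskEIT.hasSum_of_orthogonal_of_complete DiskEIT.mode_ne_zero
    DiskEIT.pairwise_inner_mode DiskEIT.eq_zero_of_inner_mode_eq_zero (hγ.toLp γ)
  set F := fun i => (inner ℝ (DiskEIT.mode i) (hγ.toLp γ) / ‖DiskEIT.mode i‖ ^ 2) •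
    DiskEIT.mode i with hF
  have hpi := Real.pi_ne_zero
  have e0 : ∀ n, F (.inl n) =
      (1 / 2 : ℝ) • DiskEIT.recCoeff (DiskEIT.Kcc γ) n 0 • DiskEIT.cosMode 0 n := by
    intro n
    have hn : (2 * n + 1 : ℝ) ≠ 0 := by positivity
    have : F (.inl n) = (inner ℝ (DiskEIT.cosMode 0 n) (hγ.toLp γ) /
      ‖DiskEIT.cosMode 0 n‖ ^ 2) • DiskEIT.cosMode 0 n := rfl
    rw [this, DiskEIT.norm_sq_cosMode_zero, DiskEIT.recCoeff_Kcc hγ, smul_smul]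
    congr 1
    push_cast
    field_simp
    ring
  -- For positive frequency the factor 2(2n+k+1)/π is exactly the inverse squared norm of the mode.
  have e1 : ∀ kn : ℕ × ℕ, F (.inr (.inl kn)) =
      DiskEIT.recCoeff (DiskEIT.Kcc γ) kn.2 (kn.1 + 1) • DiskEIT.cosMode (kn.1 + 1) kn.2 := by
    rintro ⟨k, n⟩
    have : F (.inr (.inl (k, n))) = (inner ℝ (DiskEIT.cosMode (k + 1) n) (hγ.toLp γ) /
      ‖DiskEIT.cosMode (k + 1) n‖ ^ 2) • DiskEIT.cosMode (k + 1) n := rfl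
    rw [this, DiskEIT.norm_sq_cosMode_succ, DiskEIT.recCoeff_Kcc hγ]
    congr 1
    field_simp
  have e2 : ∀ kn : ℕ × ℕ, F (.inr (.inr kn)) =
      DiskEIT.recCoeff (DiskEIT.Kcs γ) kn.2 (kn.1 + 1) • DiskEIT.sinMode (kn.1 + 1) kn.2 := by
    rintro ⟨k, n⟩
    have : F (.inr (.inr (k, n))) = (inner ℝ (DiskEIT.sinMode (k + 1) n) (hγ.toLp γ) /
      ‖DiskEIT.sinMode (k + 1) n‖ ^ 2) • DiskEIT.sinMode (k + 1) n := rfl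
    rw [this, DiskEIT.norm_sq_sinMode_succ, DiskEIT.recCoeff_Kcs hγ]
    congr 1
    field_simp
  have s0 : Summable (F ∘ Sum.inl) := hsum.summable.comp_injective Sum.inl_injective
  have s1 : Summable ((F ∘ Sum.inr) ∘ Sum.inl) :=
    hsum.summable.comp_injective (Sum.inr_injective.comp Sum.inl_injective)
  have s2 : Summable ((F ∘ Sum.inr) ∘ Sum.inr) :=
    hsum.summable.comp_injective (Sum.inr_injective.comp Sum.inr_injective)
  -- Unconditional convergence allows the basis expansion to be split over the three families.
  have htot := hsum.unique (s0.hasSum.sum (s1.hasSum.sum s2.hasSum))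
  have f0 : F ∘ Sum.inl = fun n =>
      (1 / 2 : ℝ) • DiskEIT.recCoeff (DiskEIT.Kcc γ) n 0 • DiskEIT.cosMode 0 n := funext e0
  have f1 : (F ∘ Sum.inr) ∘ Sum.inl = _ := funext e1
  have f2 : (F ∘ Sum.inr) ∘ Sum.inr = _ := funext e2
  rw [f0] at s0 htot
  rw [f1] at s1 htot
  rw [f2] at s2 htot
  have s0' : Summable fun n =>
      DiskEIT.recCoeff (DiskEIT.Kcc γ) n 0 • DiskEIT.cosMode 0 n := by
    have := s0.const_smul (2 : ℝ)
    simpa [smul_smul] using this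
  refine ⟨s0', s1, s2, ?_⟩
  rw [htot, s1.tsum_prod, s2.tsum_prod, s0'.tsum_const_smul, add_assoc]
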